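/- Let $N$ be a $C^2$ manifold of dimension $n$, let $M\ge 0$ and $h\ge 1$ be integers, let $\omega$ be a $C^1$ differential $h$-form on $N$ (its coefficients in every $C^2$ chart are of class $C^1$), let $U\subset\mathbb R^M$ be open, and let $f:U\to N$ be a map of class $C^1$. For $m\ge M$ and $A\subset\mathbb R^M$, a point $P\in\mathbb R^M$ is called an $m$-density point of $A$ if there is a $C^1$ chart $(W,\Phi)$ of $\mathbb R^M$ with $P\in W$ and $$\mathcal L^M\bigl(B_r(\Phi(P))\setminus\Phi(A\cap W)\bigr)=o(r^m)\qquad(r\to0^+),$$ where $\mathcal L^M$ is the (outer) Lebesgue measure and $B_r(x)$ the open ball of radius $r$ centred at $x$; the set of these points is denoted by $A^{(m)}$. Then, for every differential $(h-1)$-form $\lambda$ of class $C^1$ on $U$, $$U\cap\{x\in U : (d\lambda)_x=(f^*\omega)_x\}^{(M+1)}\ \subset\ \{x\in U : (f^*d\omega)_x=0\}.$$ -/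

import Mathlib

open Set Filter Topology MeasureTheory Asymptotics
open scoped Manifold

/-- A (not necessarily continuous) differential `h`-form on a manifold `X` modelled on `H` through
`I`: an alternating `h`-linear form on each tangent space. Regularity is a separate predicate. -/
abbrev ManifoldForm {E : Type*} [NormedAddCommGroup E] [NormedSpace ℝ E] {H : Type*}
    [TopologicalSpace H] (I : ModelWithCorners ℝ E H) (X : Type*) [TopologicalSpace X]
    [ChartedSpace H X] (h : ℕ) : Type _ :=
  ∀ p : X, TangentSpace I p [⋀^Fin h]→L[ℝ] ℝ

namespace ManifoldForm

section Pullback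

variable {E : Type*} [NormedAddCommGroup E] [NormedSpace ℝ E] {H : Type*} [TopologicalSpace H]
  {I : ModelWithCorners ℝ E H} {X : Type*} [TopologicalSpace X] [ChartedSpace H X]
  {E' : Type*} [NormedAddCommGroup E'] [NormedSpace ℝ E'] {H' : Type*} [TopologicalSpace H']
  {I' : ModelWithCorners ℝ E' H'} {Y : Type*} [TopologicalSpace Y] [ChartedSpace H' Y] {h : ℕ}

/-- The pullback `f^* ω`, i.e. `(f^* ω)_x (v₁, …, v_h) = ω_{f x} (df_x v₁, …, df_x v_h)`. -/
noncomputable def pullback (I' : ModelWithCorners ℝ E' H') (f : Y → X)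
    (ω : ManifoldForm I X h) : ManifoldForm I' Y h :=
  fun x => (ω (f x)).compContinuousLinearMap (mfderiv I' I f x)

end Pullback

section Charts

variable {n : ℕ} {X : Type*} [TopologicalSpace X] [ChartedSpace (EuclideanSpace ℝ (Fin n)) X]
  {h : ℕ}

/-- The local representation of `ω` in the chart `φ`, i.e. the form `(φ⁻¹)^* ω` on the open set
`φ.target` of `ℝⁿ` (only its values there are meaningful). Its value on `(e_{α₁}, …, e_{α_h})` is
the coefficient of `dx_{α₁} ∧ ⋯ ∧ dx_{α_h}`. -/
noncomputable def localRep (ω : ManifoldForm 𝓘(ℝ, EuclideanSpace ℝ (Fin n)) X h)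
    (φ : OpenPartialHomeomorph X (EuclideanSpace ℝ (Fin n))) :
    EuclideanSpace ℝ (Fin n) → EuclideanSpace ℝ (Fin n) [⋀^Fin h]→L[ℝ] ℝ :=
  pullback 𝓘(ℝ, EuclideanSpace ℝ (Fin n)) φ.symm ω

/-- `ω` is a `C¹` differential form on the `C²` manifold `X`: its local representation in every
`C²` chart of `X` is of class `C¹`. -/
def IsC1 (ω : ManifoldForm 𝓘(ℝ, EuclideanSpace ℝ (Fin n)) X h) : Prop :=
  ∀ φ ∈ IsManifold.maximalAtlas 𝓘(ℝ, EuclideanSpace ℝ (Fin n)) 2 X,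
    ContDiffOn ℝ 1 (ω.localRep φ) φ.target

/-- The exterior derivative computed in the chart `φ`: `φ^* (d ((φ⁻¹)^* ω))`. -/
noncomputable def extDerivInChart (ω : ManifoldForm 𝓘(ℝ, EuclideanSpace ℝ (Fin n)) X h)
    (φ : OpenPartialHomeomorph X (EuclideanSpace ℝ (Fin n))) :
    ManifoldForm 𝓘(ℝ, EuclideanSpace ℝ (Fin n)) X (h + 1) :=
  pullback (I := 𝓘(ℝ, EuclideanSpace ℝ (Fin n))) 𝓘(ℝ, EuclideanSpace ℝ (Fin n)) φ
    (extDeriv (ω.localRep φ))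

/-- The exterior derivative `dω` on a manifold; at `p` it is computed in the preferred chart
at `p` (for `C¹` forms the choice of chart is immaterial, see `d_eq_extDerivInChart`). -/
noncomputable def d (ω : ManifoldForm 𝓘(ℝ, EuclideanSpace ℝ (Fin n)) X h) :
    ManifoldForm 𝓘(ℝ, EuclideanSpace ℝ (Fin n)) X (h + 1) :=
  fun p => ω.extDerivInChart (chartAt (EuclideanSpace ℝ (Fin n)) p) p

end Charts

/-- The exterior derivative of a `C¹` form does not depend on the chart used to compute it. -/
theorem extDerivInChart_eq {n h : ℕ} {X : Type*} [TopologicalSpace X]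
    [ChartedSpace (EuclideanSpace ℝ (Fin n)) X] [IsManifold 𝓘(ℝ, EuclideanSpace ℝ (Fin n)) 2 X]
    (ω : ManifoldForm 𝓘(ℝ, EuclideanSpace ℝ (Fin n)) X h) (hω : ω.IsC1)
    {φ ψ : OpenPartialHomeomorph X (EuclideanSpace ℝ (Fin n))}
    (hφ : φ ∈ IsManifold.maximalAtlas 𝓘(ℝ, EuclideanSpace ℝ (Fin n)) 2 X)
    (hψ : ψ ∈ IsManifold.maximalAtlas 𝓘(ℝ, EuclideanSpace ℝ (Fin n)) 2 X)
    {p : X} (hp : p ∈ φ.source) (hp' : p ∈ ψ.source) :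
    ω.extDerivInChart φ p = ω.extDerivInChart ψ p := by
  have mφ : ∀ q ∈ φ.source, MDifferentiableAt 𝓘(ℝ, EuclideanSpace ℝ (Fin n)) 𝓘(ℝ, EuclideanSpace ℝ (Fin n)) φ q := fun q hq =>
    (contMDiffAt_of_mem_maximalAtlas hφ hq).mdifferentiableAt (by norm_num)
  have mψ : ∀ q ∈ ψ.source, MDifferentiableAt 𝓘(ℝ, EuclideanSpace ℝ (Fin n)) 𝓘(ℝ, EuclideanSpace ℝ (Fin n)) ψ q := fun q hq =>
    (contMDiffAt_of_mem_maximalAtlas hψ hq).mdifferentiableAt (by norm_num)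
  have mφs : ∀ y ∈ φ.target, MDifferentiableAt 𝓘(ℝ, EuclideanSpace ℝ (Fin n)) 𝓘(ℝ, EuclideanSpace ℝ (Fin n)) φ.symm y := fun y hy =>
    (contMDiffAt_symm_of_mem_maximalAtlas hφ hy).mdifferentiableAt (by norm_num)
  have mψs : ∀ y ∈ ψ.target, MDifferentiableAt 𝓘(ℝ, EuclideanSpace ℝ (Fin n)) 𝓘(ℝ, EuclideanSpace ℝ (Fin n)) ψ.symm y := fun y hy =>
    (contMDiffAt_symm_of_mem_maximalAtlas hψ hy).mdifferentiableAt (by norm_num)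
  set τ : EuclideanSpace ℝ (Fin n) → EuclideanSpace ℝ (Fin n) := ψ ∘ φ.symm with hτ
  set y := φ p with hy
  have hyt : y ∈ φ.target := φ.map_source hp
  have hyp : φ.symm y = p := φ.left_inv hp
  have hτs : ContDiffAt ℝ 2 τ y := by
    rw [← contMDiffAt_iff_contDiffAt]
    refine ContMDiffAt.comp (I' := 𝓘(ℝ, EuclideanSpace ℝ (Fin n))) y ?_ (contMDiffAt_symm_of_mem_maximalAtlas hφ hyt)
    rw [hyp]; exact contMDiffAt_of_mem_maximalAtlas hψ hp'
  have hrep : ω.localRep φ =ᶠ[𝓝 y]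
      fun z => (ω.localRep ψ (τ z)).compContinuousLinearMap (fderiv ℝ τ z) := by
    have hs : φ.symm ⁻¹' ψ.source ∩ φ.target ∈ 𝓝 y := by
      refine inter_mem ?_ (φ.open_target.mem_nhds hyt)
      refine (φ.continuousAt_symm hyt).preimage_mem_nhds ?_
      rw [hyp]; exact ψ.open_source.mem_nhds hp'
    filter_upwards [hs] with z hz
    have hz1 : φ.symm z ∈ ψ.source := hz.1
    have e1 : ψ.symm (τ z) = φ.symm z := ψ.left_inv hz1
    have hτz : τ z ∈ ψ.target := ψ.map_source hz1
    have e2 : mfderiv 𝓘(ℝ, EuclideanSpace ℝ (Fin n)) 𝓘(ℝ, EuclideanSpace ℝ (Fin n)) φ.symm z = (mfderiv 𝓘(ℝ, EuclideanSpace ℝ (Fin n)) 𝓘(ℝ, EuclideanSpace ℝ (Fin n)) ψ.symm (τ z)).comp (mfderiv 𝓘(ℝ, EuclideanSpace ℝ (Fin n)) 𝓘(ℝ, EuclideanSpace ℝ (Fin n)) τ z) := by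
      have : φ.symm =ᶠ[𝓝 z] ψ.symm ∘ τ := by
        have : φ.symm ⁻¹' ψ.source ∈ 𝓝 z :=
          (φ.continuousAt_symm hz.2).preimage_mem_nhds (ψ.open_source.mem_nhds hz1)
        filter_upwards [this] with w hw
        exact (ψ.left_inv hw).symm
      rw [this.mfderiv_eq]
      exact mfderiv_comp z (mψs _ hτz) ((mψ _ hz1).comp z (mφs z hz.2))
    have e3 : mfderiv 𝓘(ℝ, EuclideanSpace ℝ (Fin n)) 𝓘(ℝ, EuclideanSpace ℝ (Fin n)) τ z = fderiv ℝ τ z := mfderiv_eq_fderiv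
    rw [← e3]
    have e4 : ∀ v, ω.localRep φ z v = ω (φ.symm z) (fun i => mfderiv 𝓘(ℝ, EuclideanSpace ℝ (Fin n)) 𝓘(ℝ, EuclideanSpace ℝ (Fin n)) φ.symm z (v i)) :=
      fun v => rfl
    ext v
    rw [e4, e2]
    have key : ∀ (a b : X) (hab : a = b) (w : Fin h → EuclideanSpace ℝ (Fin n)),
      ω a w = ω b w := by intro a b hab w; subst hab; rfl
    exact (key _ _ e1 _).symm
  have hd : extDeriv (ω.localRep φ) y =
      (extDeriv (ω.localRep ψ) (τ y)).compContinuousLinearMap (fderiv ℝ τ y) := by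
    rw [hrep.extDeriv_eq]
    refine extDeriv_pullback (r := 2) ?_ hτs (by simp)
    have ht : τ y ∈ ψ.target := by
      simp only [hτ, Function.comp, hyp]; exact ψ.map_source hp'
    exact ((hω ψ hψ).contDiffAt (ψ.open_target.mem_nhds ht)).differentiableAt (by norm_num)
  have hτy : τ y = ψ p := by simp only [hτ, Function.comp, hyp]
  have e5 : mfderiv 𝓘(ℝ, EuclideanSpace ℝ (Fin n)) 𝓘(ℝ, EuclideanSpace ℝ (Fin n)) ψ p = (mfderiv 𝓘(ℝ, EuclideanSpace ℝ (Fin n)) 𝓘(ℝ, EuclideanSpace ℝ (Fin n)) τ y).comp (mfderiv 𝓘(ℝ, EuclideanSpace ℝ (Fin n)) 𝓘(ℝ, EuclideanSpace ℝ (Fin n)) φ p) := by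
    have : ψ =ᶠ[𝓝 p] τ ∘ φ := by
      filter_upwards [φ.open_source.mem_nhds hp] with w hw
      simp [hτ, φ.left_inv hw]
    rw [this.mfderiv_eq]
    exact mfderiv_comp p (hτs.contMDiffAt.mdifferentiableAt (by norm_num)) (mφ p hp)
  have e3 : mfderiv 𝓘(ℝ, EuclideanSpace ℝ (Fin n)) 𝓘(ℝ, EuclideanSpace ℝ (Fin n)) τ y = fderiv ℝ τ y := mfderiv_eq_fderiv
  ext v
  have a1 : ω.extDerivInChart φ p v
    = extDeriv (ω.localRep φ) y (fun i => mfderiv 𝓘(ℝ, EuclideanSpace ℝ (Fin n)) 𝓘(ℝ, EuclideanSpace ℝ (Fin n)) φ p (v i)) := rfl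
  have a2 : ω.extDerivInChart ψ p v
    = extDeriv (ω.localRep ψ) (ψ p) (fun i => mfderiv 𝓘(ℝ, EuclideanSpace ℝ (Fin n)) 𝓘(ℝ, EuclideanSpace ℝ (Fin n)) ψ p (v i)) := rfl
  rw [a1, a2, hd, hτy, e5, e3]
  rfl

/-- `dω` may be computed in any `C²` chart. -/
theorem d_eq_extDerivInChart {n h : ℕ} {X : Type*} [TopologicalSpace X]
    [ChartedSpace (EuclideanSpace ℝ (Fin n)) X] [IsManifold 𝓘(ℝ, EuclideanSpace ℝ (Fin n)) 2 X]
    (ω : ManifoldForm 𝓘(ℝ, EuclideanSpace ℝ (Fin n)) X h) (hω : ω.IsC1)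
    {φ : OpenPartialHomeomorph X (EuclideanSpace ℝ (Fin n))}
    (hφ : φ ∈ IsManifold.maximalAtlas 𝓘(ℝ, EuclideanSpace ℝ (Fin n)) 2 X)
    {p : X} (hp : p ∈ φ.source) : ω.d p = ω.extDerivInChart φ p :=
  extDerivInChart_eq ω hω (IsManifold.chart_mem_maximalAtlas p) hφ (mem_chart_source _ p) hp

end ManifoldForm

/-- The set `A^{(m)}` of the `m`-density points of a subset `A` of an `n`-dimensional `C¹`
manifold `X`: the points `P` such that, for some `C¹` chart `Φ` of `X` around `P` with domain `W`,
`ℒⁿ (B_r(Φ P) \ Φ (A ∩ W)) = o(r ^ m)` as `r → 0+`. -/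
def densityPoints (n : ℕ) {X : Type*} [TopologicalSpace X]
    [ChartedSpace (EuclideanSpace ℝ (Fin n)) X] (m : ℝ) (A : Set X) : Set X :=
  {P | ∃ Φ ∈ IsManifold.maximalAtlas 𝓘(ℝ, EuclideanSpace ℝ (Fin n)) 1 X, P ∈ Φ.source ∧
    (fun r : ℝ => volume.real (Metric.ball (Φ P) r \ Φ '' (A ∩ Φ.source)))
      =o[𝓝[>] (0 : ℝ)] fun r : ℝ => r ^ m}

/-! In a chart `φ` at `f P`, put `g = φ ∘ f` and let `η` represent `ω`. The form `θ = dλ - g^*η` is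
merely continuous, but it has a continuous distributional exterior derivative `τ = -g^*dη`: both
`d(dλ) = 0` and `d(g^*η) = g^*dη` hold classically for C² data and survive mollification of `λ` and
`g`, since only their first derivatives occur (`hasWeakExtDeriv_extDeriv_zero`,
`hasWeakExtDeriv_pullback`).

Test `τ` against a bump `ψ` at scale `r` around `P`. If `τ_P ≠ 0`, then for suitable vectors the
integral of `ψτ` has size at least a constant times `r^M`. Moving the derivative onto `ψ` costs
`1/r` and leaves an integral of `dψ` against `θ`, which sees only the part of the ball where `θ ≠
0`. That part has measure `o(r^(M+1))`, so the integral is `o(r^M)`, a contradiction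
(`HasWeakExtDeriv.eq_zero_of_density`). The exponent `M + 1` is exactly what absorbs the factor
`1/r`. -/

/-! ### Calculus of weak exterior derivatives. -/

section WeakExtDeriv

variable {E : Type*} [NormedAddCommGroup E] [NormedSpace ℝ E] [MeasurableSpace E]

/-- `τ` is the exterior derivative of `θ` in the sense of distributions, tested against compactly
supported `C¹` functions. -/
def HasWeakExtDeriv (μ : Measure E) {k : ℕ} (θ : E → E [⋀^Fin k]→L[ℝ] ℝ)
    (τ : E → E [⋀^Fin (k + 1)]→L[ℝ] ℝ) : Prop :=
  ∀ ψ : E → ℝ, ContDiff ℝ 1 ψ → HasCompactSupport ψ → ∀ v : Fin (k + 1) → E,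
    ∫ x, ψ x * τ x v ∂μ =
      -∑ i : Fin (k + 1), (-1) ^ (i : ℕ) * ∫ x, fderiv ℝ ψ x (v i) * θ x (i.removeNth v) ∂μ

variable [BorelSpace E] {μ : Measure E} {k : ℕ}

/-- Integration by parts in each term of the alternating sum. Regularity is asked of evaluations `α
x v`, the form in which `ContDiff.compContinuousLinearMap_apply` supplies it for pullbacks. -/
theorem hasWeakExtDeriv_extDeriv [FiniteDimensional ℝ E] [μ.IsAddHaarMeasure]
    {α : E → E [⋀^Fin k]→L[ℝ] ℝ} (hd : Differentiable ℝ α)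
    (hα : ∀ v, ContDiff ℝ 1 fun x => α x v) : HasWeakExtDeriv μ α (extDeriv α) := by
  intro ψ hψ hc v
  have hcont : ∀ i : Fin (k + 1),
      Continuous fun x => fderiv ℝ (fun y => α y (i.removeNth v)) x (v i) := fun i =>
    ((hα _).continuous_fderiv one_ne_zero).clm_apply continuous_const
  have hint : ∀ i : Fin (k + 1),
      Integrable (fun x => ψ x * fderiv ℝ (fun y => α y (i.removeNth v)) x (v i)) μ := fun i =>
    (hψ.continuous.mul (hcont i)).integrable_of_hasCompactSupport hc.mul_right
  have hparts : ∀ i : Fin (k + 1),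
      ∫ x, ψ x * fderiv ℝ (fun y => α y (i.removeNth v)) x (v i) ∂μ =
        -∫ x, fderiv ℝ ψ x (v i) * α x (i.removeNth v) ∂μ := by
    intro i
    have hψ' : Continuous fun x => fderiv ℝ ψ x (v i) :=
      (hψ.continuous_fderiv one_ne_zero).clm_apply continuous_const
    have hc' : HasCompactSupport fun x => fderiv ℝ ψ x (v i) := hc.fderiv_apply ℝ (v i)
    exact integral_mul_fderiv_eq_neg_fderiv_mul_of_integrable
      ((hψ'.mul (hα _).continuous).integrable_of_hasCompactSupport hc'.mul_right) (hint i)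
      ((hψ.continuous.mul (hα _).continuous).integrable_of_hasCompactSupport hc.mul_right)
      (fun x _ => (hψ.differentiable one_ne_zero) x)
      (fun x _ => ((hα _).differentiable one_ne_zero) x)
  calc ∫ x, ψ x * extDeriv α x v ∂μ
      = ∫ x, ∑ i : Fin (k + 1),
          (-1) ^ (i : ℕ) * (ψ x * fderiv ℝ (fun y => α y (i.removeNth v)) x (v i)) ∂μ := by
        refine integral_congr_ae (Eventually.of_forall fun x => ?_)
        simp only [extDeriv_apply (hd x), Finset.mul_sum]
        exact Finset.sum_congr rfl fun i _ => by ring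
    _ = _ := by
        rw [integral_finsetSum _ fun i _ => (hint i).const_mul _, ← Finset.sum_neg_distrib]
        refine Finset.sum_congr rfl fun i _ => ?_
        rw [integral_const_mul, hparts, mul_neg]

/-- No derivative falls on the forms, so bounded pointwise convergence suffices, by dominated
convergence on the support of the test function. -/
theorem HasWeakExtDeriv.of_tendsto [IsFiniteMeasureOnCompacts μ]
    {θ : E → E [⋀^Fin k]→L[ℝ] ℝ} {τ : E → E [⋀^Fin (k + 1)]→L[ℝ] ℝ}
    {θs : ℕ → E → E [⋀^Fin k]→L[ℝ] ℝ} {τs : ℕ → E → E [⋀^Fin (k + 1)]→L[ℝ] ℝ}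
    (hw : ∀ j, HasWeakExtDeriv μ (θs j) (τs j))
    (hθc : ∀ j, Continuous (θs j)) (hτc : ∀ j, Continuous (τs j)) {B : ℝ}
    (hθb : ∀ j x, ‖θs j x‖ ≤ B) (hτb : ∀ j x, ‖τs j x‖ ≤ B)
    (hθ : ∀ x, Tendsto (fun j => θs j x) atTop (𝓝 (θ x)))
    (hτ : ∀ x, Tendsto (fun j => τs j x) atTop (𝓝 (τ x))) :
    HasWeakExtDeriv μ θ τ := by
  intro ψ hψ hc v
  have key : ∀ {l : ℕ} {β : E → E [⋀^Fin l]→L[ℝ] ℝ} {βs : ℕ → E → E [⋀^Fin l]→L[ℝ] ℝ}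
      (_ : ∀ j, Continuous (βs j)) (_ : ∀ j x, ‖βs j x‖ ≤ B)
      (_ : ∀ x, Tendsto (fun j => βs j x) atTop (𝓝 (β x))) {χ : E → ℝ} (_ : Continuous χ)
      (_ : HasCompactSupport χ) (w : Fin l → E),
      Tendsto (fun j => ∫ x, χ x * βs j x w ∂μ) atTop (𝓝 (∫ x, χ x * β x w ∂μ)) := by
    intro l β βs h1 h2 h3 χ hχ hχc w
    have hev : Continuous fun a : E [⋀^Fin l]→L[ℝ] ℝ => a w :=
      (ContinuousAlternatingMap.apply ℝ E ℝ w).continuous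
    refine tendsto_integral_of_dominated_convergence (fun x => ‖χ x‖ * (B * ∏ i, ‖w i‖))
      (fun j => (hχ.mul (hev.comp (h1 j))).aestronglyMeasurable)
      ((hχ.norm.integrable_of_hasCompactSupport hχc.norm).mul_const _)
      (fun j => Eventually.of_forall fun x => ?_)
      (Eventually.of_forall fun x => ((hev.tendsto _).comp (h3 x)).const_mul _)
    rw [norm_mul]
    refine mul_le_mul_of_nonneg_left (((βs j x).le_opNorm w).trans ?_) (norm_nonneg _)
    exact mul_le_mul_of_nonneg_right (h2 j x) (Finset.prod_nonneg fun i _ => norm_nonneg _)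
  have hL := key hτc hτb hτ hψ.continuous hc v
  have hR : Tendsto (fun j => -∑ i : Fin (k + 1), (-1 : ℝ) ^ (i : ℕ) *
      ∫ x, fderiv ℝ ψ x (v i) * θs j x (i.removeNth v) ∂μ) atTop
      (𝓝 (-∑ i : Fin (k + 1), (-1 : ℝ) ^ (i : ℕ) *
        ∫ x, fderiv ℝ ψ x (v i) * θ x (i.removeNth v) ∂μ)) := by
    refine (tendsto_finsetSum _ fun i _ => ?_).neg
    exact (key hθc hθb hθ ((hψ.continuous_fderiv one_ne_zero).clm_apply continuous_const)
      (hc.fderiv_apply ℝ (v i)) _).const_mul _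
  refine tendsto_nhds_unique hL (hR.congr fun j => ?_)
  exact (hw j ψ hψ hc v).symm

theorem HasWeakExtDeriv.sub [IsFiniteMeasureOnCompacts μ]
    {θ₁ θ₂ : E → E [⋀^Fin k]→L[ℝ] ℝ} {τ₁ τ₂ : E → E [⋀^Fin (k + 1)]→L[ℝ] ℝ}
    (h₁ : HasWeakExtDeriv μ θ₁ τ₁) (h₂ : HasWeakExtDeriv μ θ₂ τ₂)
    (hθ₁ : Continuous θ₁) (hθ₂ : Continuous θ₂) (hτ₁ : Continuous τ₁) (hτ₂ : Continuous τ₂) :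
    HasWeakExtDeriv μ (fun x => θ₁ x - θ₂ x) (fun x => τ₁ x - τ₂ x) := by
  intro ψ hψ hc v
  have hint : ∀ {l : ℕ} {β : E → E [⋀^Fin l]→L[ℝ] ℝ} (_ : Continuous β) {χ : E → ℝ}
      (_ : Continuous χ) (_ : HasCompactSupport χ) (w : Fin l → E),
      Integrable (fun x => χ x * β x w) μ := fun hβ _ hχ hχc w =>
    (hχ.mul ((ContinuousAlternatingMap.apply ℝ E ℝ w).continuous.comp
      hβ)).integrable_of_hasCompactSupport hχc.mul_right
  have hψ' : ∀ i, Continuous fun x => fderiv ℝ ψ x (v i) := fun i =>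
    (hψ.continuous_fderiv one_ne_zero).clm_apply continuous_const
  simp only [ContinuousAlternatingMap.sub_apply, mul_sub]
  rw [integral_sub (hint hτ₁ hψ.continuous hc v) (hint hτ₂ hψ.continuous hc v),
    h₁ ψ hψ hc v, h₂ ψ hψ hc v, neg_sub_neg, ← neg_sub, ← Finset.sum_sub_distrib]
  congr 1
  refine Finset.sum_congr rfl fun i _ => ?_
  rw [integral_sub (hint hθ₁ (hψ' i) (hc.fderiv_apply ℝ (v i)) _)
    (hint hθ₂ (hψ' i) (hc.fderiv_apply ℝ (v i)) _), mul_sub]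

end WeakExtDeriv

/-! ### Mollification of C¹ maps. -/

section Mollification

open ContinuousLinearMap
open scoped Convolution

/-- A compactly supported `C¹` map is a pointwise limit, together with its derivative, of smooth
maps which are bounded together with their derivatives. -/
theorem exists_smooth_approx {E F : Type*} [NormedAddCommGroup E] [NormedSpace ℝ E]
    [FiniteDimensional ℝ E] [NormedAddCommGroup F] [NormedSpace ℝ F] [CompleteSpace F]
    {u : E → F} (hu : ContDiff ℝ 1 u) (hc : HasCompactSupport u) :
    ∃ (us : ℕ → E → F) (B : ℝ), (∀ j, ContDiff ℝ 2 (us j)) ∧ (∀ j x, ‖us j x‖ ≤ B) ∧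
      (∀ j x, ‖fderiv ℝ (us j) x‖ ≤ B) ∧ (∀ x, Tendsto (fun j => us j x) atTop (𝓝 (u x))) ∧
      ∀ x, Tendsto (fun j => fderiv ℝ (us j) x) atTop (𝓝 (fderiv ℝ u x)) := by
  let _ : MeasurableSpace E := borel E
  have : BorelSpace E := ⟨rfl⟩
  let μ : Measure E := Measure.addHaar
  let φ : ℕ → ContDiffBump (0 : E) := fun j =>
    { rIn := 1 / ((j : ℝ) + 1) / 2
      rOut := 1 / ((j : ℝ) + 1)
      rIn_pos := by positivity
      rIn_lt_rOut := half_lt_self (by positivity) }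
  have hφ : Tendsto (fun j => (φ j).rOut) atTop (𝓝 0) := tendsto_one_div_add_atTop_nhds_zero_nat
  have hu' : Continuous (fderiv ℝ u) := hu.continuous_fderiv one_ne_zero
  obtain ⟨B₁, hB₁⟩ := hu.continuous.bounded_above_of_compact_support hc
  obtain ⟨B₂, hB₂⟩ := hu'.bounded_above_of_compact_support (hc.fderiv ℝ)
  have hB : 0 ≤ max B₁ B₂ := (norm_nonneg _).trans ((hB₁ 0).trans (le_max_left _ _))
  -- The derivative is put on `u`, so bounds and limits for it are again those of a mollified
  -- continuous function.
  have hder : ∀ j x, fderiv ℝ ((φ j).normed μ ⋆[lsmul ℝ ℝ, μ] u) x =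
      ((φ j).normed μ ⋆[lsmul ℝ ℝ, μ] fderiv ℝ u) x := by
    intro j x
    rw [(hc.hasFDerivAt_convolution_right (lsmul ℝ ℝ)
      ((φ j).continuous_normed.locallyIntegrable) hu x).fderiv]
    refine integral_congr_ae (Eventually.of_forall fun y => ?_)
    ext z
    rfl
  refine ⟨fun j => (φ j).normed μ ⋆[lsmul ℝ ℝ, μ] u, max B₁ B₂, fun j => ?_, fun j x => ?_,
    fun j x => ?_, fun x => ContDiffBump.convolution_tendsto_right_of_continuous hφ hu.continuous x,
    fun x => ?_⟩
  · exact (φ j).hasCompactSupport_normed.contDiff_convolution_left (n := 2) (lsmul ℝ ℝ)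
      ((φ j).contDiff_normed) hu.continuous.locallyIntegrable
  · rw [← dist_zero_right]
    refine dist_convolution_le hB (φ j).support_normed_eq.subset (φ j).nonneg_normed
      (φ j).integral_normed hu.continuous.aestronglyMeasurable fun y _ => ?_
    rw [dist_zero_right]
    exact (hB₁ y).trans (le_max_left _ _)
  · rw [hder, ← dist_zero_right]
    refine dist_convolution_le hB (φ j).support_normed_eq.subset (φ j).nonneg_normed
      (φ j).integral_normed hu'.aestronglyMeasurable fun y _ => ?_
    rw [dist_zero_right]
    exact (hB₂ y).trans (le_max_right _ _)
  · simp only [hder]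
    exact ContDiffBump.convolution_tendsto_right_of_continuous hφ hu' x

end Mollification

/-! ### Regularity of pullbacks. -/

section PullbackOfForms

variable {E F : Type*} [NormedAddCommGroup E] [NormedSpace ℝ E]
  [NormedAddCommGroup F] [NormedSpace ℝ F] {k : ℕ}

theorem continuous_compContinuousLinearMap_uncurry :
    Continuous fun p : (F [⋀^Fin k]→L[ℝ] ℝ) × (E →L[ℝ] F) => p.1.compContinuousLinearMap p.2 :=
  continuous_iff_continuousAt.2 fun p =>
    (ContinuousAlternatingMap.hasStrictFDerivAt_compContinuousLinearMap p).continuousAt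

theorem ContDiff.continuous_extDeriv {η : E → E [⋀^Fin k]→L[ℝ] ℝ} (hη : ContDiff ℝ 1 η) :
    Continuous (extDeriv η) :=
  (ContinuousAlternatingMap.alternatizeUncurryFinCLM ℝ E ℝ (n := k)).continuous.comp
    (hη.continuous_fderiv one_ne_zero)

/-- Composition is linear in the form and multilinear in the linear maps, hence smooth in both. -/
theorem ContDiff.compContinuousLinearMap_apply {n : WithTop ℕ∞} {β : E → F [⋀^Fin k]→L[ℝ] ℝ}
    {A : E → E →L[ℝ] F} (hβ : ContDiff ℝ n β) (hA : ContDiff ℝ n A) (v : Fin k → E) :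
    ContDiff ℝ n fun x => (β x).compContinuousLinearMap (A x) v := by
  have h1 : ContDiff ℝ n fun x =>
      ContinuousMultilinearMap.compContinuousLinearMapContinuousMultilinear ℝ
        (fun _ : Fin k => E) (fun _ => F) ℝ (fun _ => A x) :=
    (ContinuousMultilinearMap.contDiff _).comp (contDiff_pi.2 fun _ => hA)
  have h2 : ContDiff ℝ n fun x =>
      ContinuousAlternatingMap.toContinuousMultilinearMapCLM ℝ (β x) :=
    (ContinuousLinearMap.contDiff _).comp hβ
  have h3 := (ContinuousLinearMap.contDiff
    (ContinuousMultilinearMap.apply ℝ (fun _ : Fin k => E) ℝ v)).comp (h1.clm_apply h2)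
  exact h3

end PullbackOfForms

/-! ### Weak derivatives of pullbacks and of exact forms. -/

section WeakExtDeriv

variable {E F : Type*} [NormedAddCommGroup E] [NormedSpace ℝ E] [FiniteDimensional ℝ E]
  [MeasurableSpace E] [BorelSpace E] {μ : Measure E} [μ.IsAddHaarMeasure]
  [NormedAddCommGroup F] [NormedSpace ℝ F] [FiniteDimensional ℝ F] {k : ℕ}

/-- Exterior derivatives commute weakly with pullbacks by `C¹` maps. -/
theorem hasWeakExtDeriv_pullback {η : F → F [⋀^Fin k]→L[ℝ] ℝ} (hη : ContDiff ℝ 1 η) {g : E → F}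
    (hg : ContDiff ℝ 1 g) (hc : HasCompactSupport g) :
    HasWeakExtDeriv μ (fun x => (η (g x)).compContinuousLinearMap (fderiv ℝ g x))
      (fun x => (extDeriv η (g x)).compContinuousLinearMap (fderiv ℝ g x)) := by
  have := FiniteDimensional.complete ℝ F
  have := FiniteDimensional.proper_real F
  have := FiniteDimensional.proper_real (E →L[ℝ] F)
  obtain ⟨gs, B, hgs, hb, hb', ht, ht'⟩ := exists_smooth_approx hg hc
  have hpull : ∀ {l : ℕ} {β : F → F [⋀^Fin l]→L[ℝ] ℝ}, Continuous β →
      Continuous fun p : F × (E →L[ℝ] F) => (β p.1).compContinuousLinearMap p.2 := fun hβ =>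
    continuous_compContinuousLinearMap_uncurry.comp
      ((hβ.comp continuous_fst).prodMk continuous_snd)
  have hbdd : ∀ {l : ℕ} {β : F → F [⋀^Fin l]→L[ℝ] ℝ}, Continuous β →
      ∃ C, ∀ j x, ‖(β (gs j x)).compContinuousLinearMap (fderiv ℝ (gs j) x)‖ ≤ C := by
    intro l β hβ
    -- The values and derivatives of all `gs j` stay in one compact product of balls, on which the
    -- pullback is bounded.
    obtain ⟨C, hC⟩ := ((isCompact_closedBall (0 : F) B).prod
      (isCompact_closedBall (0 : E →L[ℝ] F) B)).exists_bound_of_continuousOn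
      (hpull hβ).continuousOn
    exact ⟨C, fun j x => hC (gs j x, fderiv ℝ (gs j) x)
      ⟨mem_closedBall_zero_iff.2 (hb j x), mem_closedBall_zero_iff.2 (hb' j x)⟩⟩
  have hcont : ∀ {l : ℕ} {β : F → F [⋀^Fin l]→L[ℝ] ℝ}, Continuous β → ∀ j,
      Continuous fun x => (β (gs j x)).compContinuousLinearMap (fderiv ℝ (gs j) x) := fun hβ j =>
    (hpull hβ).comp ((hgs j).continuous.prodMk ((hgs j).continuous_fderiv two_ne_zero))
  have hlim : ∀ {l : ℕ} {β : F → F [⋀^Fin l]→L[ℝ] ℝ}, Continuous β → ∀ x,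
      Tendsto (fun j => (β (gs j x)).compContinuousLinearMap (fderiv ℝ (gs j) x)) atTop
        (𝓝 ((β (g x)).compContinuousLinearMap (fderiv ℝ g x))) := fun hβ x =>
    ((hpull hβ).tendsto (g x, fderiv ℝ g x)).comp ((ht x).prodMk_nhds (ht' x))
  obtain ⟨C₁, hC₁⟩ := hbdd hη.continuous
  obtain ⟨C₂, hC₂⟩ := hbdd hη.continuous_extDeriv
  refine HasWeakExtDeriv.of_tendsto (fun j => ?_) (hcont hη.continuous)
    (hcont hη.continuous_extDeriv) (B := max C₁ C₂) (fun j x => (hC₁ j x).trans (le_max_left _ _))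
    (fun j x => (hC₂ j x).trans (le_max_right _ _)) (hlim hη.continuous)
    (hlim hη.continuous_extDeriv)
  have hgd : ContDiff ℝ 1 (fderiv ℝ (gs j)) := (hgs j).fderiv_right (by norm_num)
  have hηg : ContDiff ℝ 1 fun x => η (gs j x) := hη.comp ((hgs j).of_le (by norm_num))
  have heq : extDeriv (fun x => (η (gs j x)).compContinuousLinearMap (fderiv ℝ (gs j) x)) =
      fun x => (extDeriv η (gs j x)).compContinuousLinearMap (fderiv ℝ (gs j) x) := funext fun x =>
    extDeriv_pullback (r := 2) ((hη.differentiable one_ne_zero) _) (hgs j).contDiffAt (by simp)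
  rw [← heq]
  exact hasWeakExtDeriv_extDeriv
    (fun x => ((hηg.differentiable one_ne_zero) x).continuousAlternatingMapCompContinuousLinearMap
      ((hgd.differentiable one_ne_zero) x))
    (fun v => hηg.compContinuousLinearMap_apply hgd v)

/-- The exterior derivative of a `C¹` form is weakly closed. -/
theorem hasWeakExtDeriv_extDeriv_zero {lam : E → E [⋀^Fin k]→L[ℝ] ℝ} (hlam : ContDiff ℝ 1 lam)
    (hc : HasCompactSupport lam) : HasWeakExtDeriv μ (extDeriv lam) 0 := by
  obtain ⟨ls, B, hls, -, hb', -, ht'⟩ := exists_smooth_approx hlam hc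
  let T := ContinuousAlternatingMap.alternatizeUncurryFinCLM ℝ E ℝ (n := k)
  have hB : 0 ≤ B := (norm_nonneg _).trans (hb' 0 0)
  have hd : ∀ j, ContDiff ℝ 1 (extDeriv (ls j)) := fun j =>
    T.contDiff.comp ((hls j).fderiv_right (by norm_num))
  -- The factor `k + 1` bounds the norm of the alternatization.
  refine HasWeakExtDeriv.of_tendsto (θs := fun j => extDeriv (ls j)) (τs := fun _ => 0)
    (fun j => ?_) (fun j => (hd j).continuous) (fun _ => continuous_const) (B := (k + 1) * B)
    (fun j x => (ContinuousAlternatingMap.norm_alternatizeUncurryFin_le _).trans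
      (mul_le_mul_of_nonneg_left (hb' j x) (by positivity)))
    (fun j x => by simpa using mul_nonneg (by positivity) hB)
    (fun x => (T.continuous.tendsto _).comp (ht' x)) (fun _ => tendsto_const_nhds)
  rw [← extDeriv_extDeriv (hls j) (by simp)]
  exact hasWeakExtDeriv_extDeriv ((hd j).differentiable one_ne_zero) fun v =>
    (ContinuousAlternatingMap.apply ℝ E ℝ v).contDiff.comp (hd j)

end WeakExtDeriv

theorem tendsto_const_mul_nhdsGT_zero {c : ℝ} (hc : 0 < c) :
    Tendsto (fun r : ℝ => c * r) (𝓝[>] 0) (𝓝[>] 0) := by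
  refine tendsto_nhdsWithin_iff.2 ⟨?_, ?_⟩
  · have : Tendsto (fun r : ℝ => c * r) (𝓝 0) (𝓝 (c * 0)) := tendsto_id.const_mul c
    rw [mul_zero] at this
    exact this.mono_left nhdsWithin_le_nhds
  · filter_upwards [self_mem_nhdsWithin] with r hr
    exact mul_pos hc (mem_Ioi.1 hr)

/-! ### Vanishing at superdensity points. -/

section Density

variable {E : Type*} [NormedAddCommGroup E] [NormedSpace ℝ E] [FiniteDimensional ℝ E]

/-- Rescaling one fixed bump makes `C` independent of `r`. Its support lies in the closed ball of
radius `2 * r`; with `3 * r` the function is locally zero off the open ball, so its derivative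
vanishes there too. -/
theorem exists_scaled_bump (P : E) :
    ∃ C : ℝ, 0 ≤ C ∧ ∀ r : ℝ, 0 < r → ∃ ψ : E → ℝ, ContDiff ℝ 1 ψ ∧ HasCompactSupport ψ ∧
      (∀ x, 0 ≤ ψ x) ∧ (∀ x ∈ Metric.ball P r, ψ x = 1) ∧
      (∀ x ∉ Metric.ball P (3 * r), ψ x = 0) ∧
      (∀ x ∉ Metric.ball P (3 * r), fderiv ℝ ψ x = 0) ∧ ∀ x, ‖fderiv ℝ ψ x‖ ≤ C / r := by
  let φ : ContDiffBump (0 : E) := ⟨1, 2, one_pos, one_lt_two⟩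
  have hφ : ContDiff ℝ 1 φ := φ.contDiff
  obtain ⟨C, hC⟩ := (hφ.continuous_fderiv one_ne_zero).bounded_above_of_compact_support
    (φ.hasCompactSupport.fderiv ℝ)
  refine ⟨C, (norm_nonneg _).trans (hC 0), fun r hr => ?_⟩
  have hs : ContDiff ℝ 1 fun x : E => r⁻¹ • (x - P) := by fun_prop
  have hout : ∀ x ∉ Metric.closedBall P (2 * r), φ (r⁻¹ • (x - P)) = 0 := by
    intro x hx
    refine φ.zero_of_le_dist ?_
    rw [Metric.mem_closedBall, not_le, dist_eq_norm] at hx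
    rw [dist_zero_right, norm_smul, Real.norm_of_nonneg (inv_nonneg.2 hr.le), inv_mul_eq_div,
      le_div_iff₀ hr]
    exact hx.le
  have hsub : Metric.closedBall P (2 * r) ⊆ Metric.ball P (3 * r) :=
    Metric.closedBall_subset_ball (by linarith)
  have := FiniteDimensional.proper_real E
  refine ⟨fun x => φ (r⁻¹ • (x - P)), hφ.comp hs,
    HasCompactSupport.intro (isCompact_closedBall P (2 * r)) hout, fun x => φ.nonneg,
    fun x hx => φ.one_of_mem_closedBall ?_, fun x hx => hout x fun h => hx (hsub h),
    fun x hx => ?_, fun x => ?_⟩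
  · rw [mem_closedBall_zero_iff, norm_smul, Real.norm_of_nonneg (inv_nonneg.2 hr.le),
      inv_mul_eq_div, div_le_iff₀ hr]
    rw [mem_ball_iff_norm] at hx
    simpa [φ] using hx.le
  · have : (fun x => φ (r⁻¹ • (x - P))) =ᶠ[𝓝 x] fun _ => (0 : ℝ) := by
      filter_upwards [Metric.isClosed_closedBall.isOpen_compl.mem_nhds fun h => hx (hsub h)]
        with y hy using hout y hy
    rw [this.fderiv_eq]
    simp
  · have h1 : HasFDerivAt (fun x : E => r⁻¹ • (x - P)) (r⁻¹ • ContinuousLinearMap.id ℝ E) x :=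
      ((hasFDerivAt_id x).sub_const P).const_smul r⁻¹
    have h2 := ((hφ.differentiable one_ne_zero) (r⁻¹ • (x - P))).hasFDerivAt.comp x h1
    have h3 : fderiv ℝ (fun x => φ (r⁻¹ • (x - P))) x =
        r⁻¹ • fderiv ℝ φ (r⁻¹ • (x - P)) := by
      refine h2.fderiv.trans ?_
      ext w
      simp
    rw [h3, norm_smul, Real.norm_of_nonneg (inv_nonneg.2 hr.le), inv_mul_eq_div]
    exact div_le_div_of_nonneg_right (hC _) hr.le

variable [MeasurableSpace E] [BorelSpace E] {μ : Measure E} [μ.IsAddHaarMeasure] {k : ℕ}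

/-- If a continuous form vanishes up to a set whose measure in the balls centred at `P` is
`o(r ^ (dim E + 1))`, then its weak exterior derivative vanishes at `P`. -/
theorem HasWeakExtDeriv.eq_zero_of_density {θ : E → E [⋀^Fin k]→L[ℝ] ℝ}
    {τ : E → E [⋀^Fin (k + 1)]→L[ℝ] ℝ} (hw : HasWeakExtDeriv μ θ τ) (hθ : Continuous θ)
    (hτ : Continuous τ) {P : E}
    (hP : (fun r : ℝ => μ.real (Metric.ball P r ∩ {x | θ x ≠ 0}))
      =o[𝓝[>] (0 : ℝ)] fun r : ℝ => r ^ (Module.finrank ℝ E + 1)) : τ P = 0 := by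
  ext v
  change τ P v = 0
  by_contra hne
  -- Multiplying by `c` makes the integrand close to `c * c > 0` near `P`, whatever the sign of `c`.
  set c := τ P v with hcdef
  have hτv : Continuous fun x => τ x v * c :=
    ((ContinuousAlternatingMap.apply ℝ E ℝ v).continuous.comp hτ).mul continuous_const
  have hcpos : 0 < c * c := mul_self_pos.2 hne
  obtain ⟨C, hC0, hC⟩ := exists_scaled_bump P
  have hnear : ∀ᶠ x in 𝓝 P, c * c / 2 < τ x v * c ∧ ‖θ x‖ < ‖θ P‖ + 1 :=
    ((hτv.tendsto P).eventually (lt_mem_nhds (half_lt_self hcpos))).and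
      (((hθ.norm).tendsto P).eventually (gt_mem_nhds (lt_add_one _)))
  obtain ⟨ρ, hρ, hball⟩ := Metric.eventually_nhds_iff_ball.1 hnear
  set K := ‖θ P‖ + 1 with hK
  have hK0 : 0 ≤ K := by positivity
  set D : ℝ := ∑ i : Fin (k + 1), C * ‖v i‖ * (K * ∏ j, ‖i.removeNth v j‖) with hD
  have hD0 : 0 ≤ D := Finset.sum_nonneg fun i _ =>
    mul_nonneg (mul_nonneg hC0 (norm_nonneg _))
      (mul_nonneg hK0 (Finset.prod_nonneg fun j _ => norm_nonneg _))
  set d := Module.finrank ℝ E with hd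
  set V := μ.real (Metric.ball (0 : E) 1) with hV
  have hVpos : 0 < V :=
    ENNReal.toReal_pos (Metric.measure_ball_pos μ 0 one_pos).ne' measure_ball_lt_top.ne
  -- The integral of `ψ * τ * c` is bounded below on the ball where `ψ = 1`, and above through the
  -- weak identity.
  have hineq : ∀ r : ℝ, 0 < r → 3 * r < ρ →
      c * c / 2 * (r ^ d * V) ≤
        |c| * (D / r) * μ.real (Metric.ball P (3 * r) ∩ {x | θ x ≠ 0}) := by
    intro r hr hrρ
    obtain ⟨ψ, hψ, hψc, hψ0, hψ1, hψout, hψd, hψb⟩ := hC r hr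
    have hsub : Metric.ball P (3 * r) ⊆ Metric.ball P ρ := Metric.ball_subset_ball hrρ.le
    have hint : Integrable (fun x => ψ x * (τ x v * c)) μ :=
      (hψ.continuous.mul hτv).integrable_of_hasCompactSupport hψc.mul_right
    have hlow : c * c / 2 * (r ^ d * V) ≤ ∫ x, ψ x * (τ x v * c) ∂μ := by
      have hvol : μ.real (Metric.ball P r) = r ^ d * V := by
        rw [Measure.real, Measure.addHaar_ball_of_pos μ P hr, ENNReal.toReal_mul,
          ENNReal.toReal_ofReal (by positivity)]
        rfl
      calc c * c / 2 * (r ^ d * V)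
          = ∫ x in Metric.ball P r, c * c / 2 ∂μ := by
            rw [setIntegral_const, hvol, smul_eq_mul, mul_comm]
        _ ≤ ∫ x in Metric.ball P r, ψ x * (τ x v * c) ∂μ := by
            refine setIntegral_mono_on (integrableOn_const measure_ball_lt_top.ne)
              hint.integrableOn measurableSet_ball fun x hx => ?_
            rw [hψ1 x hx, one_mul]
            exact (hball x (hsub (Metric.ball_subset_ball (by linarith) hx))).1.le
        _ ≤ ∫ x, ψ x * (τ x v * c) ∂μ := by
            refine setIntegral_le_integral hint (Eventually.of_forall fun x => ?_)
            by_cases hx : x ∈ Metric.ball P (3 * r)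
            · exact mul_nonneg (hψ0 x) ((half_pos hcpos).le.trans (hball x (hsub hx)).1.le)
            · simp [hψout x hx]
    have hup : ∫ x, ψ x * (τ x v * c) ∂μ ≤
        |c| * (D / r) * μ.real (Metric.ball P (3 * r) ∩ {x | θ x ≠ 0}) := by
      have hterm : ∀ i : Fin (k + 1),
          ‖∫ x, fderiv ℝ ψ x (v i) * θ x (i.removeNth v) ∂μ‖ ≤
            C / r * ‖v i‖ * (K * ∏ j, ‖i.removeNth v j‖) *
              μ.real (Metric.ball P (3 * r) ∩ {x | θ x ≠ 0}) := by
        intro i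
        rw [← setIntegral_eq_integral_of_forall_compl_eq_zero
          (s := Metric.ball P (3 * r) ∩ {x | θ x ≠ 0})]
        · refine norm_setIntegral_le_of_norm_le_const
            ((measure_mono inter_subset_left).trans_lt measure_ball_lt_top) fun x hx => ?_
          rw [norm_mul]
          refine mul_le_mul (((fderiv ℝ ψ x).le_opNorm _).trans
            (mul_le_mul_of_nonneg_right (hψb x) (norm_nonneg _)))
            (((θ x).le_opNorm _).trans (mul_le_mul_of_nonneg_right
              (hball x (hsub hx.1)).2.le (Finset.prod_nonneg fun j _ => norm_nonneg _)))
            (norm_nonneg _) (mul_nonneg (div_nonneg hC0 hr.le) (norm_nonneg _))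
        · intro x hx
          by_cases hx1 : x ∈ Metric.ball P (3 * r)
          · have : θ x = 0 := by
              by_contra h
              exact hx ⟨hx1, h⟩
            simp [this]
          · simp [hψd x hx1]
      have hfac : ∫ x, ψ x * (τ x v * c) ∂μ = (∫ x, ψ x * τ x v ∂μ) * c := by
        rw [← integral_mul_const]
        simp only [mul_assoc]
      rw [hfac, hw ψ hψ hψc v]
      refine (le_abs_self _).trans ?_
      rw [abs_mul, abs_neg, mul_comm, mul_assoc]
      refine mul_le_mul_of_nonneg_left ?_ (abs_nonneg _)
      refine (Finset.abs_sum_le_sum_abs _ _).trans ?_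
      rw [hD, Finset.sum_div, Finset.sum_mul]
      refine Finset.sum_le_sum fun i _ => ?_
      rw [abs_mul, abs_pow, abs_neg, abs_one, one_pow, one_mul, ← Real.norm_eq_abs]
      refine (hterm i).trans_eq ?_
      ring
    exact hlow.trans hup
  have h3 := tendsto_const_mul_nhdsGT_zero three_pos
  -- With `X = |c| * D * 3 ^ (d + 1)`, the lower bound is `2 * (X + 1) * ε * r ^ d` and the upper
  -- one `X * ε * r ^ d`. The `+ 1` keeps the denominator positive even for `D = 0`.
  set ε : ℝ := c * c / 2 * V / (2 * (|c| * D * 3 ^ (d + 1) + 1)) with hε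
  have hden : 0 < |c| * D * 3 ^ (d + 1) + 1 := by positivity
  have hεpos : 0 < ε := by positivity
  have hsmall := (hP.comp_tendsto h3).def hεpos
  have hlt : ∀ᶠ r : ℝ in 𝓝[>] 0, 3 * r < ρ :=
    (h3.mono_right nhdsWithin_le_nhds).eventually (gt_mem_nhds hρ)
  obtain ⟨r, ⟨hr1, hr2⟩, hr⟩ := ((hsmall.and hlt).and self_mem_nhdsWithin).exists
  have hr : 0 < r := hr
  simp only [Function.comp_apply] at hr1
  rw [Real.norm_of_nonneg measureReal_nonneg, Real.norm_of_nonneg (by positivity)] at hr1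
  have hfin := (hineq r hr hr2).trans
    (mul_le_mul_of_nonneg_left hr1 (mul_nonneg (abs_nonneg c) (div_nonneg hD0 hr.le)))
  have hcalc : |c| * (D / r) * (ε * (3 * r) ^ (d + 1)) =
      (|c| * D * 3 ^ (d + 1)) * ε * r ^ d := by
    rw [mul_pow, pow_succ r d]
    field_simp
  have hεeq : c * c / 2 * V = 2 * (|c| * D * 3 ^ (d + 1) + 1) * ε := by
    rw [hε]
    field_simp
  have hrd : 0 < r ^ d := pow_pos hr d
  rw [hcalc] at hfin
  have hX : 0 ≤ |c| * D * 3 ^ (d + 1) := by positivity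
  have hfin' : c * c / 2 * V ≤ |c| * D * 3 ^ (d + 1) * ε :=
    le_of_mul_le_mul_right (by linarith) hrd
  rw [hεeq] at hfin'
  nlinarith [mul_nonneg hX hεpos.le]

end Density

/-! ### Reduction to global data and to the identity chart. -/

section Localization

/-- A cutoff near `P` preserves the germ, all that the conclusion at `P` depends on, and gives the
global compactly supported data of the weak calculus. -/
theorem ContDiffAt.exists_contDiff_eventuallyEq {E F : Type*} [NormedAddCommGroup E]
    [NormedSpace ℝ E] [FiniteDimensional ℝ E] [NormedAddCommGroup F] [NormedSpace ℝ F]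
    {u : E → F} {P : E} (hu : ContDiffAt ℝ 1 u P) :
    ∃ u' : E → F, ContDiff ℝ 1 u' ∧ HasCompactSupport u' ∧ u' =ᶠ[𝓝 P] u := by
  have hs : {x | ContDiffAt ℝ 1 u x} ∈ 𝓝 P := hu.eventually (by simp)
  obtain ⟨ρ, hρ, hball⟩ := Metric.mem_nhds_iff.1 hs
  let φ : ContDiffBump (P : E) := ⟨ρ / 3, ρ / 2, by positivity, by linarith⟩
  have hsup : tsupport φ ⊆ Metric.ball P ρ := by
    rw [φ.tsupport_eq]
    exact Metric.closedBall_subset_ball (half_lt_self hρ)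
  refine ⟨fun x => φ x • u x, ?_, φ.hasCompactSupport.smul_right, ?_⟩
  · rw [contDiff_iff_contDiffAt]
    intro x
    by_cases hx : x ∈ tsupport φ
    · exact φ.contDiffAt.smul (hball (hsup hx))
    · refine (contDiffAt_const (c := (0 : F))).congr_of_eventuallyEq ?_
      filter_upwards [(isClosed_tsupport φ).isOpen_compl.mem_nhds hx] with y hy
      rw [image_eq_zero_of_notMem_tsupport hy, zero_smul]
  · filter_upwards [φ.eventuallyEq_one] with x hx
    rw [hx, Pi.one_apply, one_smul]

/-- Density points with respect to some `C¹` chart of `ℝⁿ` are density points with respect to the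
identity chart. -/
theorem isLittleO_measure_ball_diff_of_mem_densityPoints {n m : ℕ}
    {A : Set (EuclideanSpace ℝ (Fin n))} {P : EuclideanSpace ℝ (Fin n)}
    (hP : P ∈ densityPoints n (m : ℝ) A) :
    (fun r : ℝ => volume.real (Metric.ball P r \ A)) =o[𝓝[>] (0 : ℝ)] fun r : ℝ => r ^ m := by
  obtain ⟨Φ, hΦ, hPs, ho⟩ := hP
  have hΦd : ContDiffAt ℝ 1 Φ P := by
    rw [← contMDiffAt_iff_contDiffAt]
    exact contMDiffAt_of_mem_maximalAtlas hΦ hPs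
  have hg : ContDiffAt ℝ 1 Φ.symm (Φ P) := by
    rw [← contMDiffAt_iff_contDiffAt]
    exact contMDiffAt_symm_of_mem_maximalAtlas hΦ (Φ.map_source hPs)
  have hstrict := hg.hasStrictFDerivAt one_ne_zero
  set g' := fderiv ℝ Φ.symm (Φ P)
  -- Near `Φ P` the inverse chart is almost linear, so it enlarges outer measure by at most any `m'
  -- > |det g'|`; no measurability of `A` is needed.
  obtain ⟨m', hm'⟩ := ENNReal.lt_iff_exists_nnreal_btwn.1
    (ENNReal.ofReal_lt_top (r := |g'.det|))
  obtain ⟨δ, hδ, hδ0⟩ := ((addHaar_image_le_mul_of_det_lt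
    (volume : Measure (EuclideanSpace ℝ (Fin n))) g' hm'.1).and self_mem_nhdsWithin).exists
  obtain ⟨t, ht, happ⟩ := hstrict.approximates_deriv_on_nhds (c := δ) (Or.inr hδ0)
  obtain ⟨ρ, hρ, hρt⟩ := Metric.mem_nhds_iff.1 ht
  -- For small `r`, `Φ` maps the `r`-ball at `P` into the `L * r`-ball at `Φ P`.
  obtain ⟨L, hL0, hL⟩ := ((hΦd.differentiableAt one_ne_zero).isBigO_sub).exists_pos
  obtain ⟨σ, hσ, hσb⟩ := Metric.eventually_nhds_iff_ball.1
    (hL.bound.and (Φ.open_source.mem_nhds hPs))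
  have hle : ∀ r : ℝ, 0 < r → r < σ → L * r < ρ → volume.real (Metric.ball P r \ A) ≤
      m' * volume.real (Metric.ball (Φ P) (L * r) \ Φ '' (A ∩ Φ.source)) := by
    intro r hr hrσ hrρ
    have hsub : Metric.ball P r \ A ⊆
        Φ.symm '' (Metric.ball (Φ P) (L * r) \ Φ '' (A ∩ Φ.source)) := by
      rintro x ⟨hx, hxA⟩
      obtain ⟨h1, h2⟩ := hσb x (Metric.ball_subset_ball hrσ.le hx)
      refine ⟨Φ x, ⟨?_, ?_⟩, Φ.left_inv h2⟩
      · rw [mem_ball_iff_norm] at hx ⊢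
        exact h1.trans_lt (mul_lt_mul_of_pos_left hx hL0)
      · rintro ⟨y, ⟨hyA, hys⟩, hyx⟩
        exact hxA (Φ.injOn hys h2 hyx ▸ hyA)
    have happ' : ApproximatesLinearOn Φ.symm g'
        (Metric.ball (Φ P) (L * r) \ Φ '' (A ∩ Φ.source)) δ :=
      happ.mono_set ((sdiff_subset.trans (Metric.ball_subset_ball hrρ.le)).trans hρt)
    have hvol := (measure_mono hsub).trans (hδ _ _ happ')
    have hfin : volume (Metric.ball (Φ P) (L * r) \ Φ '' (A ∩ Φ.source)) ≠ ⊤ :=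
      ((measure_mono sdiff_subset).trans_lt measure_ball_lt_top).ne
    have := ENNReal.toReal_mono (ENNReal.mul_ne_top ENNReal.coe_ne_top hfin) hvol
    rwa [ENNReal.toReal_mul, ENNReal.coe_toReal] at this
  have hmul := tendsto_const_mul_nhdsGT_zero hL0
  have ho' : (fun r : ℝ => volume.real
      (Metric.ball (Φ P) (L * r) \ Φ '' (A ∩ Φ.source))) =o[𝓝[>] (0 : ℝ)] fun r : ℝ => r ^ m := by
    have h1 := ho.comp_tendsto hmul
    refine h1.trans_isBigO (IsBigO.of_bound (L ^ m) ?_)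
    filter_upwards [self_mem_nhdsWithin] with r hr
    rw [Function.comp_apply, Real.rpow_natCast, mul_pow, norm_mul,
      Real.norm_of_nonneg (pow_nonneg hL0.le m)]
  refine IsBigO.trans_isLittleO (IsBigO.of_bound m' ?_) ho'
  have hsmall : ∀ᶠ r : ℝ in 𝓝[>] 0, r < σ :=
    (gt_mem_nhds hσ).filter_mono nhdsWithin_le_nhds
  filter_upwards [self_mem_nhdsWithin, hsmall,
    (hmul.mono_right nhdsWithin_le_nhds).eventually (gt_mem_nhds hρ)] with r h1 h2 h3
  rw [Real.norm_of_nonneg measureReal_nonneg, Real.norm_of_nonneg measureReal_nonneg]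
  exact hle r h1 h2 h3

end Localization

/-! ### Euclidean case and passage to the manifold. -/

/-- The Euclidean case: `d(g^* η)` vanishes at the superdensity points of `{dλ = g^* η}`. -/
theorem extDeriv_compContinuousLinearMap_eq_zero_of_density {E F : Type*} [NormedAddCommGroup E]
    [NormedSpace ℝ E] [FiniteDimensional ℝ E] [MeasurableSpace E] [BorelSpace E] {μ : Measure E}
    [μ.IsAddHaarMeasure] [NormedAddCommGroup F] [NormedSpace ℝ F] [FiniteDimensional ℝ F] {k : ℕ}
    {η : F → F [⋀^Fin (k + 1)]→L[ℝ] ℝ} {g : E → F} {lam : E → E [⋀^Fin k]→L[ℝ] ℝ} {P : E}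
    (hη : ContDiffAt ℝ 1 η (g P)) (hg : ContDiffAt ℝ 1 g P) (hlam : ContDiffAt ℝ 1 lam P)
    {A : Set E}
    (hA : ∀ᶠ x in 𝓝 P,
      x ∈ A → extDeriv lam x = (η (g x)).compContinuousLinearMap (fderiv ℝ g x))
    (hP : (fun r : ℝ => μ.real (Metric.ball P r \ A))
      =o[𝓝[>] (0 : ℝ)] fun r : ℝ => r ^ (Module.finrank ℝ E + 1)) :
    (extDeriv η (g P)).compContinuousLinearMap (fderiv ℝ g P) = 0 := by
  obtain ⟨η', hη', -, hηe⟩ := hη.exists_contDiff_eventuallyEq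
  obtain ⟨g', hg', hgc, hge⟩ := hg.exists_contDiff_eventuallyEq
  obtain ⟨lam', hlam', hlc, hle⟩ := hlam.exists_contDiff_eventuallyEq
  have hcont : ∀ {l : ℕ} {β : F → F [⋀^Fin l]→L[ℝ] ℝ}, Continuous β →
      Continuous fun x => (β (g' x)).compContinuousLinearMap (fderiv ℝ g' x) := fun hβ =>
    continuous_compContinuousLinearMap_uncurry.comp
      ((hβ.comp hg'.continuous).prodMk (hg'.continuous_fderiv one_ne_zero))
  have hc1 := hcont hη'.continuous
  have hc2 := hcont hη'.continuous_extDeriv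
  have hw := (hasWeakExtDeriv_extDeriv_zero (μ := μ) hlam' hlc).sub
    (hasWeakExtDeriv_pullback hη' hg' hgc) hlam'.continuous_extDeriv hc1 continuous_const hc2
  have hagree : ∀ᶠ x in 𝓝 P, x ∈ A →
      extDeriv lam' x - (η' (g' x)).compContinuousLinearMap (fderiv ℝ g' x) = 0 := by
    filter_upwards [hA, hle.extDeriv, hge, hge.fderiv (𝕜 := ℝ), hg.continuousAt.eventually hηe]
      with x h1 h2 h3 h4 h5 hx
    rw [h2, h3, h4, h5, h1 hx, sub_self]
  obtain ⟨ρ, hρ, hball⟩ := Metric.eventually_nhds_iff_ball.1 hagree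
  have hz := hw.eq_zero_of_density (hlam'.continuous_extDeriv.sub hc1) (continuous_const.sub hc2)
    (P := P) <| by
      refine IsBigO.trans_isLittleO (IsBigO.of_bound 1 ?_) hP
      filter_upwards [(gt_mem_nhds hρ).filter_mono nhdsWithin_le_nhds] with r hr
      rw [Real.norm_of_nonneg measureReal_nonneg, Real.norm_of_nonneg measureReal_nonneg, one_mul]
      refine measureReal_mono (fun x hx => ⟨hx.1, fun hxA => hx.2 ?_⟩)
        ((measure_mono sdiff_subset).trans_lt measure_ball_lt_top).ne
      exact hball x (Metric.ball_subset_ball hr.le hx.1) hxA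
  rw [Pi.zero_apply, zero_sub, neg_eq_zero, hge.fderiv_eq, hge.eq_of_nhds,
    hηe.extDeriv_eq] at hz
  exact hz

theorem theorem4p1 (M n k : ℕ) {N : Type*} [TopologicalSpace N]
    [ChartedSpace (EuclideanSpace ℝ (Fin n)) N]
    [IsManifold 𝓘(ℝ, EuclideanSpace ℝ (Fin n)) 2 N]
    (ω : ManifoldForm 𝓘(ℝ, EuclideanSpace ℝ (Fin n)) N (k + 1)) (hω : ω.IsC1)
    (U : Set (EuclideanSpace ℝ (Fin M))) (hU : IsOpen U)
    (f : EuclideanSpace ℝ (Fin M) → N)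
    (hf : ContMDiffOn 𝓘(ℝ, EuclideanSpace ℝ (Fin M)) 𝓘(ℝ, EuclideanSpace ℝ (Fin n)) 1 f U)
    (lam : EuclideanSpace ℝ (Fin M) → EuclideanSpace ℝ (Fin M) [⋀^Fin k]→L[ℝ] ℝ)
    (hlam : ContDiffOn ℝ 1 lam U) :
    U ∩ densityPoints M (M + 1 : ℝ)
        {x | x ∈ U ∧ extDeriv lam x = ω.pullback 𝓘(ℝ, EuclideanSpace ℝ (Fin M)) f x} ⊆
      {x | x ∈ U ∧ ω.d.pullback 𝓘(ℝ, EuclideanSpace ℝ (Fin M)) f x = 0} := by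
  rintro P ⟨hPU, hPd⟩
  refine ⟨hPU, ?_⟩
  have hdens := isLittleO_measure_ball_diff_of_mem_densityPoints (m := M + 1)
    (by exact_mod_cast hPd)
  -- `ω.d` at `f P` is defined through this very chart, so no change of chart is needed.
  set φ := chartAt (EuclideanSpace ℝ (Fin n)) (f P) with hφdef
  have hφ : φ ∈ IsManifold.maximalAtlas 𝓘(ℝ, EuclideanSpace ℝ (Fin n)) 2 N :=
    IsManifold.chart_mem_maximalAtlas (f P)
  have hfP : f P ∈ φ.source := mem_chart_source _ (f P)
  have hfat : ∀ x ∈ U, ContMDiffAt 𝓘(ℝ, EuclideanSpace ℝ (Fin M))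
      𝓘(ℝ, EuclideanSpace ℝ (Fin n)) 1 f x := fun x hx => hf.contMDiffAt (hU.mem_nhds hx)
  have hφat : ∀ q ∈ φ.source, ContMDiffAt 𝓘(ℝ, EuclideanSpace ℝ (Fin n))
      𝓘(ℝ, EuclideanSpace ℝ (Fin n)) 2 φ q := fun q hq => contMDiffAt_of_mem_maximalAtlas hφ hq
  have hgat : ∀ x ∈ U, f x ∈ φ.source → ContDiffAt ℝ 1 (φ ∘ f) x := by
    intro x hx hfx
    rw [← contMDiffAt_iff_contDiffAt]
    exact ContMDiffAt.comp x ((hφat _ hfx).of_le (by norm_num)) (hfat x hx)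
  have hnear : ∀ᶠ x in 𝓝 P, x ∈ U ∧ f x ∈ φ.source :=
    (hU.eventually_mem hPU).and ((hfat P hPU).continuousAt.preimage_mem_nhds
      (φ.open_source.mem_nhds hfP))
  -- Transports values between the fibres at `f x` and `φ.symm (φ (f x))`, which are only
  -- propositionally the same point.
  have hpt : ∀ (a b : N) (_ : a = b) (w : Fin (k + 1) → EuclideanSpace ℝ (Fin n)),
      ω a w = ω b w := by
    intro a b hab w
    subst hab
    rfl
  have hpull : ∀ᶠ x in 𝓝 P, ω.pullback 𝓘(ℝ, EuclideanSpace ℝ (Fin M)) f x =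
      (ω.localRep φ ((φ ∘ f) x)).compContinuousLinearMap (fderiv ℝ (φ ∘ f) x) := by
    filter_upwards [hnear.eventually_nhds] with x hx
    obtain ⟨hxU, hxs⟩ := hx.self_of_nhds
    have heq : f =ᶠ[𝓝 x] φ.symm ∘ (φ ∘ f) := hx.mono fun y hy => (φ.left_inv hy.2).symm
    have hmf : mfderiv 𝓘(ℝ, EuclideanSpace ℝ (Fin M)) 𝓘(ℝ, EuclideanSpace ℝ (Fin n)) f x =
        (mfderiv 𝓘(ℝ, EuclideanSpace ℝ (Fin n)) 𝓘(ℝ, EuclideanSpace ℝ (Fin n)) φ.symm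
          ((φ ∘ f) x)).comp (mfderiv 𝓘(ℝ, EuclideanSpace ℝ (Fin M))
            𝓘(ℝ, EuclideanSpace ℝ (Fin n)) (φ ∘ f) x) := by
      rw [heq.mfderiv_eq]
      exact mfderiv_comp x ((contMDiffAt_symm_of_mem_maximalAtlas hφ
        (φ.map_source hxs)).mdifferentiableAt (by norm_num))
        ((hgat x hxU hxs).contMDiffAt.mdifferentiableAt (by norm_num))
    rw [← mfderiv_eq_fderiv]
    ext v
    have h1 : ω.pullback 𝓘(ℝ, EuclideanSpace ℝ (Fin M)) f x v =
        ω (f x) (fun i => mfderiv 𝓘(ℝ, EuclideanSpace ℝ (Fin M))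
          𝓘(ℝ, EuclideanSpace ℝ (Fin n)) f x (v i)) := rfl
    rw [h1, hmf]
    exact hpt _ _ (φ.left_inv hxs).symm _
  have hz := extDeriv_compContinuousLinearMap_eq_zero_of_density
    (μ := (volume : Measure (EuclideanSpace ℝ (Fin M)))) (η := ω.localRep φ) (g := φ ∘ f)
    (lam := lam) (P := P)
    (A := {x | x ∈ U ∧ extDeriv lam x = ω.pullback 𝓘(ℝ, EuclideanSpace ℝ (Fin M)) f x})
    ((hω φ hφ).contDiffAt (φ.open_target.mem_nhds (φ.map_source hfP))) (hgat P hPU hfP)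
    (hlam.contDiffAt (hU.mem_nhds hPU)) (hpull.mono fun x hx hxA => hxA.2.trans hx)
    (by simpa using hdens)
  have hmd : mfderiv 𝓘(ℝ, EuclideanSpace ℝ (Fin M)) 𝓘(ℝ, EuclideanSpace ℝ (Fin n)) (φ ∘ f) P =
      (mfderiv 𝓘(ℝ, EuclideanSpace ℝ (Fin n)) 𝓘(ℝ, EuclideanSpace ℝ (Fin n)) φ (f P)).comp
        (mfderiv 𝓘(ℝ, EuclideanSpace ℝ (Fin M)) 𝓘(ℝ, EuclideanSpace ℝ (Fin n)) f P) :=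
    mfderiv_comp P ((hφat _ hfP).mdifferentiableAt (by norm_num))
      ((hfat P hPU).mdifferentiableAt (by norm_num))
  rw [← mfderiv_eq_fderiv, hmd] at hz
  exact hz
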